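/- Let $G$ be a second countable locally compact group with neutral element $e$ and left Haar measure $m$. **Notation.** A set $A\subseteq G\times G$ is *marginally null* if $A\subseteq (M\times G)\cup(G\times M)$ for some $m$-null set $M\subseteq G$. Write $A\cong B$ (*marginally equivalent*) if the symmetric difference of $A$ and $B$ is marginally null, and $A\subseteq_\omega B$ if $A\setminus B$ is marginally null. A *rectangle* is a set $\alpha\times\beta$, and a *square* a set $\alpha\times\alpha$, with $\alpha,\beta\subseteq G$ Borel. A set is *$\omega$-open* if it is marginally equivalent to a countable union of rectangles. The *$\omega$-union* of a family of $\omega$-open sets is the smallest (with respect to $\subseteq_\omega$; it exists and is unique up to $\cong$) $\omega$-open set which marginally contains each member of the family. For $\kappa\subseteq G\times G$, the *$\omega$-interior* $\mathrm{int}_\omega(\kappa)$ (resp. the *square interior* $\mathrm{int}_\square(\kappa)$) is the $\omega$-union of all rectangles (resp. squares) contained in $\kappa$, and the *$\omega$-closure* is $\mathrm{cl}_\omega(\kappa)=(\mathrm{int}_\omega(\kappa^c))^c$. A measurable set $\kappa$ is a *positivity domain* if $\kappa\cong\mathrm{cl}_\omega(\mathrm{int}_\omega(\kappa))$, $\kappa\cong\{(x,y):(y,x)\in\kappa\}$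 and $\{(x,x):x\in G\}\subseteq_\omega\kappa$. A set $\kappa$ is *generated by squares* if $\kappa\cong\mathrm{cl}_\omega(\mathrm{int}_\square(\kappa))$. For $E\subseteq G$ put $E^*=\{(s,t)\in G\times G: ts^{-1}\in E\}$. $G$ *satisfies the Lebesgue Density Theorem* if there is a left invariant metric on $G$ which induces its topology and such that, for every Borel set $\alpha\subseteq G$, $m$-almost every $t\in\alpha$ satisfies $\lim_{\varepsilon\to0} m(\alpha\cap B(t,\varepsilon))/m(B(t,\varepsilon))=1$, where $B(t,\varepsilon)$ is the open ball with centre $t$ and radius $\varepsilon$. **Theorem.** Suppose that $G$ satisfies the Lebesgue Density Theorem and let $E\subseteq G$ be a Borel set with $m(E)>0$. Then $$\mathrm{int}_\omega(E^*)\cong \mathrm{int}(E)^*\quad\text{and}\quad \mathrm{cl}_\omega(E^*)\cong \mathrm{cl}(E)^*.$$ Moreover: (i) $E^*$ is a positivity domain if and only if $E=E^{-1}$, $e\in E$ and $E$ is the closure of its interior. (ii) $E^*$ contains a square of non-zero $m\times m$-measure if and only if $E$ contains a symmetric open neighbourhood of $e$. If $E^*$ is generated by squares, then it contains such a square; and if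 $E^*$ is a positivity domain, then conversely $E^*$ is generated by squares whenever it contains such a square. -/

import Mathlib

open Set MeasureTheory Filter Topology
open scoped ENNReal Pointwise

namespace OmegaTop

section MeasureSpaces

variable {X : Type*} [MeasurableSpace X]

/-- `A ⊆ X × X` is marginally null: `A ⊆ (M × X) ∪ (X × M)` for some null set `M`. -/
def MargNull (μ : Measure X) (A : Set (X × X)) : Prop :=
  ∃ M : Set X, μ M = 0 ∧ A ⊆ (M ×ˢ univ) ∪ (univ ×ˢ M)

/-- Marginal containment `A ⊆_ω B`. -/
def MargSubset (μ : Measure X) (A B : Set (X × X)) : Prop :=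
  MargNull μ (A \ B)

/-- Marginal equivalence `A ≅ B`: the symmetric difference is marginally null. -/
def MargEquiv (μ : Measure X) (A B : Set (X × X)) : Prop :=
  MargNull μ (symmDiff A B)

/-- A rectangle `α × β` with measurable sides. -/
def IsRectangle (R : Set (X × X)) : Prop :=
  ∃ α β : Set X, MeasurableSet α ∧ MeasurableSet β ∧ R = α ×ˢ β

/-- A square `α × α` with measurable side. -/
def IsSquareSet (Q : Set (X × X)) : Prop :=
  ∃ α : Set X, MeasurableSet α ∧ Q = α ×ˢ α

/-- `A` is `ω`-open: marginally equivalent to a countable union of rectangles. -/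
def IsOmegaOpen (μ : Measure X) (A : Set (X × X)) : Prop :=
  ∃ R : ℕ → Set (X × X), (∀ n, IsRectangle (R n)) ∧ MargEquiv μ A (⋃ n, R n)

/-- `U` is a smallest (with respect to marginal containment) `ω`-open set which marginally
contains every member of `𝓔`. -/
def IsOmegaUnion (μ : Measure X) (𝓔 : Set (Set (X × X))) (U : Set (X × X)) : Prop :=
  IsOmegaOpen μ U ∧ (∀ A ∈ 𝓔, MargSubset μ A U) ∧
    ∀ V, IsOmegaOpen μ V → (∀ A ∈ 𝓔, MargSubset μ A V) → MargSubset μ U V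

open Classical in
/-- The `ω`-union of a family `𝓔` of `ω`-open sets: a chosen representative of the marginal
equivalence class of smallest `ω`-open sets marginally containing every member of `𝓔`.
On the spaces of interest it always exists, see `isOmegaUnion_omegaUnion`, and it is unique up to
marginal equivalence, see `IsOmegaUnion.margEquiv`. -/
noncomputable def omegaUnion (μ : Measure X) (𝓔 : Set (Set (X × X))) : Set (X × X) :=
  if h : ∃ U, IsOmegaUnion μ 𝓔 U then h.choose else ∅

/-- The `ω`-interior: the `ω`-union of all rectangles contained in `κ`. -/
noncomputable def omegaInterior (μ : Measure X) (κ : Set (X × X)) : Set (X × X) :=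
  omegaUnion μ {R | IsRectangle R ∧ R ⊆ κ}

/-- The `ω`-closure: the complement of the `ω`-interior of the complement. -/
noncomputable def omegaClosure (μ : Measure X) (κ : Set (X × X)) : Set (X × X) :=
  (omegaInterior μ κᶜ)ᶜ

/-- The square interior: the `ω`-union of all squares contained in `κ`. -/
noncomputable def squareInterior (μ : Measure X) (κ : Set (X × X)) : Set (X × X) :=
  omegaUnion μ {Q | IsSquareSet Q ∧ Q ⊆ κ}

/-- `κ ≅ cl_ω (int_ω κ)`. -/
def GeneratedByRectangles (μ : Measure X) (κ : Set (X × X)) : Prop :=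
  MargEquiv μ κ (omegaClosure μ (omegaInterior μ κ))

/-- `κ ≅ cl_ω (int_□ κ)`. -/
def GeneratedBySquares (μ : Measure X) (κ : Set (X × X)) : Prop :=
  MargEquiv μ κ (omegaClosure μ (squareInterior μ κ))

/-- A positivity domain: a measurable set which is generated by rectangles, is marginally
equivalent to its flip, and marginally contains the diagonal. -/
def IsPositivityDomain (μ : Measure X) (κ : Set (X × X)) : Prop :=
  MeasurableSet κ ∧ GeneratedByRectangles μ κ ∧ MargEquiv μ κ (Prod.swap ⁻¹' κ) ∧
    MargSubset μ (diagonal X) κ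

/-- `κ` contains a square which is not null for the product measure. -/
def ContainsNonNullSquare (μ : Measure X) (κ : Set (X × X)) : Prop :=
  ∃ Q, IsSquareSet Q ∧ (μ.prod μ) Q ≠ 0 ∧ Q ⊆ κ

/-! The `ω`-union is well defined. -/

theorem MargNull.mono {μ : Measure X} {A B : Set (X × X)} (h : MargNull μ B) (hAB : A ⊆ B) :
    MargNull μ A := by
  obtain ⟨M, hM, hB⟩ := h
  exact ⟨M, hM, hAB.trans hB⟩

theorem MargNull.iUnion {μ : Measure X} {ι : Sort*} [Countable ι] {A : ι → Set (X × X)}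
    (h : ∀ i, MargNull μ (A i)) : MargNull μ (⋃ i, A i) := by
  choose M hM hA using h
  refine ⟨⋃ i, M i, measure_iUnion_null hM, iUnion_subset fun i x hx => ?_⟩
  rcases hA i hx with h | h
  · exact Or.inl ⟨mem_iUnion.2 ⟨i, h.1⟩, trivial⟩
  · exact Or.inr ⟨trivial, mem_iUnion.2 ⟨i, h.2⟩⟩

theorem MargNull.union {μ : Measure X} {A B : Set (X × X)} (hA : MargNull μ A)
    (hB : MargNull μ B) : MargNull μ (A ∪ B) := by
  rw [union_eq_iUnion]
  exact MargNull.iUnion fun b => by cases b <;> simpa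

theorem MargSubset.trans {μ : Measure X} {A B C : Set (X × X)} (hAB : MargSubset μ A B)
    (hBC : MargSubset μ B C) : MargSubset μ A C := by
  refine (MargNull.union hAB hBC).mono fun x hx => ?_
  by_cases h : x ∈ B
  · exact Or.inr ⟨h, hx.2⟩
  · exact Or.inl ⟨hx.1, h⟩

theorem IsOmegaUnion.margEquiv {μ : Measure X} {𝓔 : Set (Set (X × X))} {U V : Set (X × X)}
    (hU : IsOmegaUnion μ 𝓔 U) (hV : IsOmegaUnion μ 𝓔 V) : MargEquiv μ U V :=
  MargNull.union (hU.2.2 V hV.1 hV.2.1) (hV.2.2 U hU.1 hU.2.1)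

theorem exists_countable_cover (μ : Measure X) [SFinite μ]
    [MeasurableSpace.CountablyGenerated X] (F : Set (Set X × Set X))
    (hF : ∀ p ∈ F, MeasurableSet p.1 ∧ MeasurableSet p.2) :
    ∃ F₀ ⊆ F, F₀.Countable ∧ ∀ p ∈ F, MargSubset μ (p.1 ×ˢ p.2) (⋃ q ∈ F₀, q.1 ×ˢ q.2) := by
  obtain ⟨ν, hν, hμν⟩ : ∃ ν : Measure X, IsFiniteMeasure ν ∧ μ ≪ ν := by
    obtain ⟨ν, h1, h2, -⟩ := exists_isFiniteMeasure_absolutelyContinuous μ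
    exact ⟨ν, h1, h2⟩
  have : Fact ((1 : ℝ≥0∞) ≠ ∞) := ⟨ENNReal.one_ne_top⟩
  let φ : F → Lp ℝ 1 ν × Lp ℝ 1 ν := fun p =>
    (indicatorConstLp 1 (hF p p.2).1 (measure_ne_top ν _) 1,
      indicatorConstLp 1 (hF p p.2).2 (measure_ne_top ν _) 1)
  let _ : TopologicalSpace F := TopologicalSpace.induced φ inferInstance
  have : SecondCountableTopology F := TopologicalSpace.secondCountableTopology_induced _ _ φ
  have hφ : Continuous φ := continuous_induced_dom
  obtain ⟨D, hDc, hDd⟩ := TopologicalSpace.exists_countable_dense F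
  refine ⟨(↑) '' D, by rintro _ ⟨x, -, rfl⟩; exact x.2, hDc.image _, fun p hp => ?_⟩
  have key : ∀ n : ℕ, ∃ q ∈ D, dist (φ ⟨p, hp⟩) (φ q) < (1 / 2 : ℝ) ^ n := by
    intro n
    have ho : IsOpen (φ ⁻¹' (Metric.ball (φ ⟨p, hp⟩) ((1 / 2 : ℝ) ^ n))) :=
      Metric.isOpen_ball.preimage hφ
    obtain ⟨q, hq, hqD⟩ := hDd.inter_open_nonempty _ ho
      ⟨⟨p, hp⟩, Metric.mem_ball_self (by positivity)⟩
    exact ⟨q, hqD, by rw [dist_comm]; exact hq⟩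
  choose q hqD hq using key
  have aux : ∀ {s t : Set X} (hs : MeasurableSet s) (ht : MeasurableSet t) (n : ℕ),
      dist (indicatorConstLp 1 hs (measure_ne_top ν _) (1 : ℝ))
        (indicatorConstLp 1 ht (measure_ne_top ν _) (1 : ℝ)) < (1 / 2 : ℝ) ^ n →
      ν (s \ t) ≤ ENNReal.ofReal ((1 / 2 : ℝ) ^ n) := by
    intro s t hs ht n h
    rw [dist_indicatorConstLp_eq_norm, norm_indicatorConstLp one_ne_zero ENNReal.one_ne_top] at h
    simp only [norm_one, ENNReal.toReal_one, one_mul, div_one, Real.rpow_one] at h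
    calc ν (s \ t) ≤ ν (symmDiff s t) := measure_mono subset_union_left
      _ = ENNReal.ofReal (ν.real (symmDiff s t)) := by simp [Measure.real]
      _ ≤ _ := ENNReal.ofReal_le_ofReal h.le
  have hsum : ∑' n : ℕ, ENNReal.ofReal ((1 / 2 : ℝ) ^ n) ≠ ∞ :=
    summable_geometric_two.tsum_ofReal_ne_top
  have h1 : ∀ᵐ x ∂ν, ∀ᶠ n in atTop, x ∉ p.1 \ (q n : Set X × Set X).1 := by
    refine ae_eventually_notMem (ne_top_of_le_ne_top hsum (ENNReal.tsum_le_tsum fun n => ?_))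
    exact aux (hF p hp).1 (hF _ (q n).2).1 n (lt_of_le_of_lt (le_max_left _ _) (hq n))
  have h2 : ∀ᵐ x ∂ν, ∀ᶠ n in atTop, x ∉ p.2 \ (q n : Set X × Set X).2 := by
    refine ae_eventually_notMem (ne_top_of_le_ne_top hsum (ENNReal.tsum_le_tsum fun n => ?_))
    exact aux (hF p hp).2 (hF _ (q n).2).2 n (lt_of_le_of_lt (le_max_right _ _) (hq n))
  refine ⟨_, measure_union_null (hμν h1) (hμν h2), ?_⟩
  rintro ⟨x, y⟩ ⟨⟨hx, hy⟩, hn⟩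
  by_contra hcon
  have hx' : ∀ᶠ n in atTop, x ∉ p.1 \ (q n : Set X × Set X).1 := by
    by_contra h; exact hcon (Or.inl ⟨Or.inl h, trivial⟩)
  have hy' : ∀ᶠ n in atTop, y ∉ p.2 \ (q n : Set X × Set X).2 := by
    by_contra h; exact hcon (Or.inr ⟨trivial, Or.inr h⟩)
  obtain ⟨n, hxn, hyn⟩ := (hx'.and hy').exists
  refine hn (mem_biUnion (mem_image_of_mem _ (hqD n)) ⟨?_, ?_⟩)
  · by_contra h; exact hxn ⟨hx, h⟩
  · by_contra h; exact hyn ⟨hy, h⟩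

theorem exists_isOmegaUnion (μ : Measure X) [SFinite μ]
    [MeasurableSpace.CountablyGenerated X] (𝓔 : Set (Set (X × X)))
    (h𝓔 : ∀ A ∈ 𝓔, IsOmegaOpen μ A) : ∃ U, IsOmegaUnion μ 𝓔 U := by
  let F : Set (Set X × Set X) := {p | (MeasurableSet p.1 ∧ MeasurableSet p.2) ∧
    ∃ A ∈ 𝓔, MargSubset μ (p.1 ×ˢ p.2) A}
  obtain ⟨F₀, hF₀, hc, hcov⟩ := exists_countable_cover μ F fun p hp => hp.1
  have := hc.to_subtype
  refine ⟨⋃ q ∈ F₀, q.1 ×ˢ q.2, ?_, fun A hA => ?_, fun V _ hV => ?_⟩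
  · obtain rfl | hne := F₀.eq_empty_or_nonempty
    · refine ⟨fun _ => ∅, fun _ => ⟨∅, ∅, .empty, .empty, by simp⟩, ∅, by simp, by simp⟩
    · obtain ⟨f, rfl⟩ := hc.exists_eq_range hne
      refine ⟨fun n => (f n).1 ×ˢ (f n).2, fun n => ?_, ∅, by simp, by simp⟩
      exact ⟨_, _, (hF₀ (mem_range_self n)).1.1, (hF₀ (mem_range_self n)).1.2, rfl⟩
  · obtain ⟨R, hR, hAR⟩ := h𝓔 A hA
    have h1 : MargSubset μ A (⋃ n, R n) := MargNull.mono hAR subset_union_left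
    have h2 : MargSubset μ (⋃ n, R n) A := MargNull.mono hAR subset_union_right
    refine h1.trans ?_
    rw [MargSubset, iUnion_sdiff]
    refine MargNull.iUnion fun n => ?_
    obtain ⟨α, β, hα, hβ, hn⟩ := hR n
    rw [hn]
    refine hcov (α, β) ⟨⟨hα, hβ⟩, A, hA, MargNull.mono h2 ?_⟩
    exact sdiff_subset_sdiff_left (hn ▸ subset_iUnion R n)
  · rw [MargSubset, biUnion_eq_iUnion, iUnion_sdiff]
    refine MargNull.iUnion fun q => ?_
    obtain ⟨-, A, hA, hqA⟩ := hF₀ q.2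
    exact hqA.trans (hV A hA)

theorem isOmegaUnion_omegaUnion (μ : Measure X) [SFinite μ]
    [MeasurableSpace.CountablyGenerated X] (𝓔 : Set (Set (X × X)))
    (h𝓔 : ∀ A ∈ 𝓔, IsOmegaOpen μ A) : IsOmegaUnion μ 𝓔 (omegaUnion μ 𝓔) := by
  have h := exists_isOmegaUnion μ 𝓔 h𝓔
  rw [omegaUnion, dif_pos h]
  exact h.choose_spec

end MeasureSpaces

section Groups

variable {G : Type*} [Group G]

/-- `E* = {(s, t) : t s⁻¹ ∈ E}`. -/
def star (E : Set G) : Set (G × G) :=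
  {p | p.2 * p.1⁻¹ ∈ E}

/-- With respect to the metric `d`, `t` is a point of density of `α`:
`m (α ∩ B(t, ε)) / m (B(t, ε)) → 1` as `ε → 0`, with `B(t, ε)` the open ball. -/
def IsDensityPoint [MeasurableSpace G] (m : Measure G) (d : MetricSpace G) (α : Set G) (t : G) :
    Prop :=
  Tendsto (fun ε : ℝ => m (α ∩ {s | d.dist s t < ε}) / m {s | d.dist s t < ε})
    (𝓝[>] 0) (𝓝 1)

/-- `G` satisfies the Lebesgue Density Theorem: for some left invariant metric inducing the
topology of `G`, almost every point of every Borel set `α` is a point of density of `α`. -/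
def SatisfiesLebesgueDensity [TopologicalSpace G] [MeasurableSpace G] (m : Measure G) : Prop :=
  ∃ d : MetricSpace G,
    d.toUniformSpace.toTopologicalSpace = ‹TopologicalSpace G› ∧
    (∀ r s t : G, d.dist (r * s) (r * t) = d.dist s t) ∧
    ∀ α : Set G, MeasurableSet α → m (α \ {s ∈ α | IsDensityPoint m d α s}) = 0

end Groups

end OmegaTop

namespace OmegaTop

/-! ### Calculus of marginal containment and equivalence -/

section MarginalRelations

variable {X : Type*} [MeasurableSpace X] {μ : Measure X}

/-! The crux is a Steinhaus argument. Let `α ×ˢ β ⊆ star E`, with `s`, `t` density points of `α`,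
`β`. The translates `s⁻¹α` and `t⁻¹β` each fill more than half of a small ball at `1`, so a slight
left translate of `s⁻¹α` by `g` still meets `t⁻¹β`, and hence `t * g * s⁻¹ ∈ E`. Thus `t * s⁻¹ ∈
interior E` (`mul_inv_mem_interior_of_isDensityPoint`), and by the density theorem every rectangle
in `star E` lies marginally in `star (interior E)`.

Conversely, that open set is a countable union of open rectangles, which identifies the
`ω`-interior; complements give the `ω`-closure. Since `star E` determines `E` even up to marginal
equivalence (`margEquiv_star_iff`), the remaining claims become topological statements about `E`. -/

theorem MargNull.empty : MargNull μ (∅ : Set (X × X)) :=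
  ⟨∅, by simp, by simp⟩

theorem MargSubset.of_subset {A B : Set (X × X)} (h : A ⊆ B) : MargSubset μ A B := by
  rw [MargSubset, sdiff_eq_empty.2 h]
  exact MargNull.empty

theorem MargEquiv.subset {A B : Set (X × X)} (h : MargEquiv μ A B) : MargSubset μ A B :=
  MargNull.mono h subset_union_left

theorem MargEquiv.of_subsets {A B : Set (X × X)} (h : MargSubset μ A B)
    (h' : MargSubset μ B A) : MargEquiv μ A B :=
  MargNull.union h h'

theorem MargEquiv.refl (A : Set (X × X)) : MargEquiv μ A A :=
  .of_subsets (.of_subset subset_rfl) (.of_subset subset_rfl)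

theorem MargEquiv.symm {A B : Set (X × X)} (h : MargEquiv μ A B) : MargEquiv μ B A := by
  rwa [MargEquiv, symmDiff_comm]

theorem MargEquiv.trans {A B C : Set (X × X)} (h : MargEquiv μ A B) (h' : MargEquiv μ B C) :
    MargEquiv μ A C :=
  .of_subsets (h.subset.trans h'.subset) (h'.symm.subset.trans h.symm.subset)

theorem MargEquiv.compl {A B : Set (X × X)} (h : MargEquiv μ A B) : MargEquiv μ Aᶜ Bᶜ := by
  rwa [MargEquiv, compl_symmDiff_compl]

theorem MargNull.prod_left {s : Set X} (hs : μ s = 0) (t : Set X) : MargNull μ (s ×ˢ t) :=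
  ⟨s, hs, fun _ hx => Or.inl ⟨hx.1, trivial⟩⟩

theorem MargNull.prod_right (s : Set X) {t : Set X} (ht : μ t = 0) : MargNull μ (s ×ˢ t) :=
  ⟨t, ht, fun _ hx => Or.inr ⟨trivial, hx.2⟩⟩

theorem IsRectangle.isOmegaOpen {R : Set (X × X)} (h : IsRectangle R) : IsOmegaOpen μ R :=
  ⟨fun _ => R, fun _ => h, by rw [iUnion_const]; exact .refl R⟩

theorem IsSquareSet.isRectangle {Q : Set (X × X)} (h : IsSquareSet Q) : IsRectangle Q := by
  obtain ⟨α, hα, rfl⟩ := h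
  exact ⟨α, α, hα, hα, rfl⟩

theorem IsRectangle.empty : IsRectangle (∅ : Set (X × X)) :=
  ⟨∅, ∅, .empty, .empty, by simp⟩

theorem IsOmegaUnion.omegaUnion {𝓔 : Set (Set (X × X))} {U : Set (X × X)}
    (h : IsOmegaUnion μ 𝓔 U) : MargEquiv μ (omegaUnion μ 𝓔) U := by
  have hex : ∃ U, IsOmegaUnion μ 𝓔 U := ⟨U, h⟩
  rw [OmegaTop.omegaUnion, dif_pos hex]
  exact hex.choose_spec.margEquiv h

theorem IsOmegaUnion.of_forall_exists_margSubset {𝓔 𝓕 : Set (Set (X × X))} {U : Set (X × X)}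
    (h : IsOmegaUnion μ 𝓔 U) (h₁ : ∀ A ∈ 𝓔, ∃ B ∈ 𝓕, MargSubset μ A B)
    (h₂ : ∀ B ∈ 𝓕, ∃ A ∈ 𝓔, MargSubset μ B A) : IsOmegaUnion μ 𝓕 U := by
  refine ⟨h.1, fun B hB => ?_, fun V hV hV' => h.2.2 V hV fun A hA => ?_⟩
  · obtain ⟨A, hA, hBA⟩ := h₂ B hB
    exact hBA.trans (h.2.1 A hA)
  · obtain ⟨B, hB, hAB⟩ := h₁ A hA
    exact hAB.trans (hV' B hB)

/-- Removing a measurable null set from both sides turns marginal containment into true containment.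
Hence the `ω`-interior respects marginal equivalence. -/
theorem exists_isRectangle_subset_of_margSubset {R κ κ' : Set (X × X)} (hR : IsRectangle R)
    (hRκ : R ⊆ κ) (h : MargSubset μ κ κ') :
    ∃ R', (IsRectangle R' ∧ R' ⊆ κ') ∧ MargSubset μ R R' := by
  obtain ⟨α, β, hα, hβ, rfl⟩ := hR
  obtain ⟨M, hM, hsub⟩ := h
  obtain ⟨N, hMN, hN, hN0⟩ := exists_measurable_superset_of_null hM
  refine ⟨(α \ N) ×ˢ (β \ N), ⟨⟨_, _, hα.diff hN, hβ.diff hN, rfl⟩, fun x hx => ?_⟩,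
    N, hN0, fun x hx => ?_⟩
  · by_contra hx'
    rcases hsub ⟨hRκ ⟨hx.1.1, hx.2.1⟩, hx'⟩ with h | h
    · exact hx.1.2 (hMN h.1)
    · exact hx.2.2 (hMN h.2)
  · by_contra hx'
    simp only [mem_union, mem_prod, mem_univ, and_true, true_and, not_or] at hx'
    exact hx.2 ⟨⟨hx.1.1, hx'.1⟩, hx.1.2, hx'.2⟩

variable [SFinite μ] [MeasurableSpace.CountablyGenerated X]

theorem MargEquiv.omegaInterior {κ κ' : Set (X × X)} (h : MargEquiv μ κ κ') :
    MargEquiv μ (omegaInterior μ κ) (omegaInterior μ κ') :=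
  ((isOmegaUnion_omegaUnion μ {R | IsRectangle R ∧ R ⊆ κ'}
    fun _ hR => hR.1.isOmegaOpen).of_forall_exists_margSubset
    (fun _ hR => exists_isRectangle_subset_of_margSubset hR.1 hR.2 h.symm.subset)
    (fun _ hR => exists_isRectangle_subset_of_margSubset hR.1 hR.2 h.subset)).omegaUnion

theorem MargEquiv.omegaClosure {κ κ' : Set (X × X)} (h : MargEquiv μ κ κ') :
    MargEquiv μ (omegaClosure μ κ) (omegaClosure μ κ') :=
  h.compl.omegaInterior.compl

end MarginalRelations

/-! ### Open sets as `ω`-unions -/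

section OpenSets

variable {X : Type*} [TopologicalSpace X]

theorem exists_isRectangle_of_mem_isOpen [MeasurableSpace X]
    [OpensMeasurableSpace X] {O : Set (X × X)} (hO : IsOpen O) {p : X × X}
    (hp : p ∈ O) : ∃ R, IsRectangle R ∧ IsOpen R ∧ p ∈ R ∧ R ⊆ O := by
  obtain ⟨u, v, hu, hv, hpu, hpv, huv⟩ := isOpen_prod_iff.1 hO p.1 p.2 hp
  exact ⟨u ×ˢ v, ⟨u, v, hu.measurableSet, hv.measurableSet, rfl⟩, hu.prod hv, ⟨hpu, hpv⟩, huv⟩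

variable [SecondCountableTopology X]

theorem exists_countable_sUnion_eq_of_isOpen {𝓔 : Set (Set X)} {O : Set X}
    (h : ∀ p ∈ O, ∃ A ∈ 𝓔, IsOpen A ∧ p ∈ A ∧ A ⊆ O) :
    ∃ T ⊆ 𝓔, T.Countable ∧ ⋃₀ T = O := by
  obtain ⟨T, hTc, hT, hTU⟩ := TopologicalSpace.isOpen_sUnion_countable
    {A | A ∈ 𝓔 ∧ IsOpen A ∧ A ⊆ O} fun A hA => hA.2.1
  refine ⟨T, fun A hA => (hT hA).1, hTc, hTU.trans (Subset.antisymm ?_ fun p hp => ?_)⟩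
  · exact sUnion_subset fun A hA => hA.2.2
  · obtain ⟨A, hA, hAo, hpA, hAO⟩ := h p hp
    exact ⟨A, ⟨hA, hAo, hAO⟩, hpA⟩

variable [MeasurableSpace X] [OpensMeasurableSpace X]

theorem IsOpen.isOmegaOpen (μ : Measure X) {O : Set (X × X)} (hO : IsOpen O) :
    IsOmegaOpen μ O := by
  obtain ⟨T, hT, hTc, hTO⟩ := exists_countable_sUnion_eq_of_isOpen (𝓔 := {R | IsRectangle R})
    fun p hp => exists_isRectangle_of_mem_isOpen hO hp
  -- Adjoining `∅` allows an enumeration by `ℕ` even when `T` is empty.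
  obtain ⟨f, hf⟩ := (hTc.insert ∅).exists_eq_range (insert_nonempty _ _)
  refine ⟨f, fun n => ?_, ?_⟩
  · have hn : f n ∈ insert ∅ T := hf ▸ mem_range_self n
    rcases hn with hn | hn
    · exact hn ▸ IsRectangle.empty
    · exact hT hn
  · rw [← sUnion_range, ← hf, sUnion_insert, empty_union, hTO]
    exact .refl O

/-- By the Lindelöf property countably many members already cover `O`, and marginal nullity survives
countable unions only. -/
theorem isOmegaUnion_of_isOpen {μ : Measure X} {𝓔 : Set (Set (X × X))} {O : Set (X × X)}
    (hO : IsOpen O) (h𝓔 : ∀ A ∈ 𝓔, MargSubset μ A O)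
    (h : ∀ p ∈ O, ∃ A ∈ 𝓔, IsOpen A ∧ p ∈ A ∧ A ⊆ O) : IsOmegaUnion μ 𝓔 O := by
  refine ⟨IsOpen.isOmegaOpen μ hO, h𝓔, fun V _ hV => ?_⟩
  obtain ⟨T, hT, hTc, rfl⟩ := exists_countable_sUnion_eq_of_isOpen h
  have := hTc.to_subtype
  rw [MargSubset, sUnion_eq_iUnion, iUnion_sdiff]
  exact MargNull.iUnion fun A => hV A (hT A.2)

end OpenSets

/-! ### Sets of the form `E*` -/

section StarSets

variable {G : Type*} [Group G]

theorem star_compl (E : Set G) : star Eᶜ = (star E)ᶜ := rfl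

theorem swap_preimage_star (E : Set G) : Prod.swap ⁻¹' star E = star E⁻¹ := by
  ext p
  simp [star]

theorem star_subset_star {E F : Set G} (h : E ⊆ F) : star E ⊆ star F := fun _ hp => h hp

theorem isOpen_star [TopologicalSpace G] [IsTopologicalGroup G] {E : Set G} (hE : IsOpen E) :
    IsOpen (star E) :=
  hE.preimage (continuous_snd.mul continuous_fst.inv)

variable [MeasurableSpace G] {m : Measure G}

/-- If `g ∈ E`, the graph of `x ↦ g * x` lies in `star E`, so `G` would be covered by the null sets
`M` and `g⁻¹M`. -/
theorem eq_empty_of_margNull_star [MeasurableMul G] [m.IsMulLeftInvariant] [NeZero m]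
    {E : Set G} (h : MargNull m (star E)) : E = ∅ := by
  obtain ⟨M, hM, hsub⟩ := h
  refine eq_empty_of_forall_notMem fun g hg => NeZero.ne m ?_
  rw [← Measure.measure_univ_eq_zero]
  refine measure_mono_null (t := M ∪ (g * ·) ⁻¹' M) (fun x _ => ?_) (measure_union_null hM ?_)
  · have hx : (x, g * x) ∈ star E := by simpa [star] using hg
    rcases hsub hx with h | h
    · exact Or.inl h.1
    · exact Or.inr h.2
  · rwa [measure_preimage_mul]

theorem margEquiv_star_iff [MeasurableMul G] [m.IsMulLeftInvariant] [NeZero m]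
    {E F : Set G} : MargEquiv m (star E) (star F) ↔ E = F := by
  refine ⟨fun h => ?_, fun h => h ▸ .refl _⟩
  have h' : MargNull m (star (symmDiff E F)) := h
  exact symmDiff_eq_bot.1 (eq_empty_of_margNull_star h')

theorem margSubset_diagonal_star_iff [NeZero m] {E : Set G} :
    MargSubset m (diagonal G) (star E) ↔ (1 : G) ∈ E := by
  refine ⟨fun ⟨M, hM, hsub⟩ => ?_, fun h => .of_subset fun p hp => ?_⟩
  · by_contra h1
    refine NeZero.ne m (Measure.measure_univ_eq_zero.1 (measure_mono_null (fun x _ => ?_) hM))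
    rcases hsub (show (x, x) ∈ diagonal G \ star E from ⟨rfl, by simpa [star] using h1⟩) with h | h
    · exact h.1
    · exact h.2
  · rw [mem_diagonal_iff] at hp
    simpa [star, hp] using h

end StarSets

/-! ### Density points and the main equivalences -/

section Density

variable {G : Type*} [Group G] [TopologicalSpace G] [IsTopologicalGroup G]
  [MeasurableSpace G] [BorelSpace G]

/-- The side of the square is a neighbourhood of `s` united with one of `t`. Two of the four blocks
are controlled by `1 ∈ O`, the other two by `p` and the symmetry of `O`. -/
theorem exists_isOpen_square_subset_star {O : Set G} (hO : IsOpen O) (hinv : O⁻¹ = O)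
    (h1 : (1 : G) ∈ O) {p : G × G} (hp : p ∈ star O) :
    ∃ Q, IsSquareSet Q ∧ IsOpen Q ∧ p ∈ Q ∧ Q ⊆ star O := by
  have hsymm : ∀ {a b : G}, b * a⁻¹ ∈ O → a * b⁻¹ ∈ O := fun {a b} hab => by
    rw [← hinv]
    simpa using hab
  have hdiag : ∀ a : G, (a, a) ∈ star O := fun a => by simpa [star] using h1
  obtain ⟨s, t⟩ := p
  obtain ⟨u, v, hu, hv, hsu, htv, huv⟩ := isOpen_prod_iff.1 (isOpen_star hO) s t hp
  obtain ⟨u', u'', hu', hu'', hsu', hsu'', huu⟩ :=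
    isOpen_prod_iff.1 (isOpen_star hO) s s (hdiag s)
  obtain ⟨v', v'', hv', hv'', htv', htv'', hvv⟩ :=
    isOpen_prod_iff.1 (isOpen_star hO) t t (hdiag t)
  have hopen : IsOpen ((u ∩ (u' ∩ u'')) ∪ (v ∩ (v' ∩ v''))) :=
    (hu.inter (hu'.inter hu'')).union (hv.inter (hv'.inter hv''))
  refine ⟨_, ⟨_, hopen.measurableSet, rfl⟩, hopen.prod hopen,
    ⟨Or.inl ⟨hsu, hsu', hsu''⟩, Or.inr ⟨htv, htv', htv''⟩⟩, ?_⟩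
  rintro ⟨a, b⟩ ⟨ha | ha, hb | hb⟩
  · exact huu ⟨ha.2.1, hb.2.2⟩
  · exact huv ⟨ha.1, hb.1⟩
  · exact hsymm (huv (show (b, a) ∈ u ×ˢ v from ⟨hb.1, ha.1⟩))
  · exact hvv ⟨ha.2.1, hb.2.2⟩

variable {m : Measure G} [m.IsHaarMeasure]

theorem exists_measure_ball_lt_two_mul {d : MetricSpace G}
    (hd : ∀ r s t : G, d.dist (r * s) (r * t) = d.dist s t) {α : Set G} {t : G}
    (h : IsDensityPoint m d α t) :
    ∀ᶠ ε in 𝓝[>] (0 : ℝ),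
      m {s | d.dist s 1 < ε} < 2 * m ((t * ·) ⁻¹' α ∩ {s | d.dist s 1 < ε}) := by
  filter_upwards [h.eventually (lt_mem_nhds (show (2⁻¹ : ℝ≥0∞) < 1 by norm_num))] with ε hε
  have hball : (t * ·) ⁻¹' {s | d.dist s t < ε} = {s | d.dist s 1 < ε} := by
    ext s
    have := hd t s 1
    rw [mul_one] at this
    simp [this]
  rw [← hball, ← preimage_inter, measure_preimage_mul, measure_preimage_mul]
  generalize m {s | d.dist s t < ε} = b at hε ⊢
  generalize m (α ∩ {s | d.dist s t < ε}) = a at hε ⊢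
  have hlt : 2⁻¹ * b < a := ENNReal.mul_lt_of_lt_div hε
  have h2 : (2 : ℝ≥0∞) * (2⁻¹ * b) < 2 * a :=
    ENNReal.mul_lt_mul_right (by norm_num) (by norm_num) hlt
  rwa [← mul_assoc, ENNReal.mul_inv_cancel (by norm_num) (by norm_num), one_mul] at h2

variable [LocallyCompactSpace G] [SecondCountableTopology G]

theorem mul_inv_mem_interior_of_isDensityPoint {d : MetricSpace G}
    (hdt : d.toUniformSpace.toTopologicalSpace = ‹TopologicalSpace G›)
    (hd : ∀ r s t : G, d.dist (r * s) (r * t) = d.dist s t) {α β E : Set G} {s t : G}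
    (hα : MeasurableSet α) (hβ : MeasurableSet β) (hs : IsDensityPoint m d α s)
    (ht : IsDensityPoint m d β t) (h : α ×ˢ β ⊆ star E) : t * s⁻¹ ∈ interior E := by
  obtain ⟨ε, hεα, hεβ⟩ := ((exists_measure_ball_lt_two_mul hd hs).and
    (exists_measure_ball_lt_two_mul hd ht)).exists
  set B : Set G := {x | d.dist x 1 < ε}
  have hB : IsOpen B := by
    subst hdt
    exact Metric.isOpen_ball
  set α' := (s * ·) ⁻¹' α
  set β' := (t * ·) ⁻¹' β
  have hα' : MeasurableSet α' := measurable_const_mul s hα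
  have hβ' : MeasurableSet β' := measurable_const_mul t hβ
  have hBtop : m B ≠ ∞ := hεα.ne_top
  have hhalf : m B / 2 < m (α' ∩ B) := ENNReal.div_lt_of_lt_mul' hεα
  -- Compactness of `K` keeps `g * K` inside the open `B` for all `g` near `1`, while `K` still has
  -- more than half the measure of `B`.
  obtain ⟨K, hKsub, hK, hKm⟩ := (hα'.inter hB.measurableSet).exists_lt_isCompact_of_ne_top
    (measure_ne_top_of_subset inter_subset_right hBtop) hhalf
  obtain ⟨W, hW, hWK⟩ := compact_open_separated_mul_left hK hB (hKsub.trans inter_subset_right)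
  have hnhds : {x : G | t⁻¹ * x * s ∈ W} ∈ 𝓝 (t * s⁻¹) := by
    have hc : Continuous fun x : G => t⁻¹ * x * s := by fun_prop
    exact hc.continuousAt.preimage_mem_nhds (by simpa using hW)
  refine mem_interior_iff_mem_nhds.2 (mem_of_superset hnhds fun x hx => ?_)
  set g := t⁻¹ * x * s with hg
  -- This preimage is `g * K`. Two subsets of `B`, each of more than half its measure, must meet.
  have hgK : (g⁻¹ * ·) ⁻¹' K ⊆ B := fun y hy => by
    have hgy : g * (g⁻¹ * y) ∈ B := hWK (mul_mem_mul hx hy)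
    rwa [mul_inv_cancel_left] at hgy
  have hne : ((g⁻¹ * ·) ⁻¹' K ∩ (β' ∩ B)).Nonempty := by
    refine nonempty_inter_of_measure_lt_add m (hβ'.inter hB.measurableSet) hgK
      inter_subset_right ?_
    rw [measure_preimage_mul]
    calc m B = m B / 2 + m B / 2 := (ENNReal.add_halves _).symm
      _ < _ := ENNReal.add_lt_add hKm (ENNReal.div_lt_of_lt_mul' hεβ)
  obtain ⟨y, hyK, hyβ, -⟩ := hne
  have hmem : (s * (g⁻¹ * y), t * y) ∈ star E := h ⟨(hKsub hyK).1, hyβ⟩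
  have heq : t * y * (s * (g⁻¹ * y))⁻¹ = x := by rw [hg]; group
  exact heq ▸ hmem

theorem IsRectangle.margSubset_star_interior (hG : SatisfiesLebesgueDensity m)
    {E : Set G} {R : Set (G × G)} (hR : IsRectangle R) (h : R ⊆ star E) :
    MargSubset m R (star (interior E)) := by
  obtain ⟨α, β, hα, hβ, rfl⟩ := hR
  obtain ⟨d, hdt, hd, hdens⟩ := hG
  refine MargNull.mono ((MargNull.prod_left (hdens α hα) β).union
    (MargNull.prod_right α (hdens β hβ))) fun p hp => ?_
  by_contra hcon
  obtain ⟨⟨hp₁, hp₂⟩, hpE⟩ := hp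
  refine hpE (mul_inv_mem_interior_of_isDensityPoint (m := m) hdt hd hα hβ ?_ ?_ h)
  · by_contra hs
    exact hcon (Or.inl ⟨⟨hp₁, fun hs' => hs hs'.2⟩, hp₂⟩)
  · by_contra ht
    exact hcon (Or.inr ⟨hp₁, hp₂, fun ht' => ht ht'.2⟩)

theorem omegaInterior_star (hG : SatisfiesLebesgueDensity m) (E : Set G) :
    MargEquiv m (omegaInterior m (star E)) (star (interior E)) := by
  refine (isOmegaUnion_of_isOpen (isOpen_star isOpen_interior)
    (fun R hR => hR.1.margSubset_star_interior hG hR.2) fun p hp => ?_).omegaUnion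
  obtain ⟨R, hR, hRo, hpR, hRE⟩ :=
    exists_isRectangle_of_mem_isOpen (isOpen_star isOpen_interior) hp
  exact ⟨R, ⟨hR, hRE.trans (star_subset_star interior_subset)⟩, hRo, hpR, hRE⟩

theorem omegaClosure_star (hG : SatisfiesLebesgueDensity m) (E : Set G) :
    MargEquiv m (omegaClosure m (star E)) (star (closure E)) := by
  rw [closure_eq_compl_interior_compl, star_compl]
  exact (omegaInterior_star hG Eᶜ).compl

theorem generatedByRectangles_star_iff (hG : SatisfiesLebesgueDensity m) (E : Set G) :
    GeneratedByRectangles m (star E) ↔ closure (interior E) = E := by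
  have h : MargEquiv m (omegaClosure m (omegaInterior m (star E)))
      (star (closure (interior E))) :=
    (omegaInterior_star hG E).omegaClosure.trans (omegaClosure_star hG _)
  rw [eq_comm, ← margEquiv_star_iff (m := m)]
  exact ⟨fun h' => h'.trans h, fun h' => h'.trans h.symm⟩

theorem isPositivityDomain_star_iff (hG : SatisfiesLebesgueDensity m) {E : Set G}
    (hE : MeasurableSet E) : IsPositivityDomain m (star E) ↔
      E⁻¹ = E ∧ (1 : G) ∈ E ∧ closure (interior E) = E := by
  have hmeas : MeasurableSet (star E) := (measurable_snd.mul measurable_fst.inv) hE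
  rw [IsPositivityDomain, generatedByRectangles_star_iff hG, swap_preimage_star,
    margEquiv_star_iff, margSubset_diagonal_star_iff, eq_comm (a := E)]
  tauto

theorem containsNonNullSquare_star_iff (hG : SatisfiesLebesgueDensity m) (E : Set G) :
    ContainsNonNullSquare m (star E) ↔
      ∃ U : Set G, IsOpen U ∧ U⁻¹ = U ∧ (1 : G) ∈ U ∧ U ⊆ E := by
  constructor
  · rintro ⟨_, ⟨α, hα, rfl⟩, hne, hsub⟩
    obtain ⟨d, hdt, hd, hdens⟩ := hG
    -- One density point of `α` serves both sides of the square, giving `t * t⁻¹ = 1`.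
    obtain ⟨t, -, ht⟩ : {s ∈ α | IsDensityPoint m d α s}.Nonempty := by
      rw [nonempty_iff_ne_empty]
      intro hemp
      have h0 := hdens α hα
      rw [hemp, sdiff_empty] at h0
      exact hne (by rw [Measure.prod_prod, h0, zero_mul])
    have h1 : (1 : G) ∈ interior E := by
      simpa using mul_inv_mem_interior_of_isDensityPoint hdt hd hα hα ht ht hsub
    exact ⟨interior E ∩ (interior E)⁻¹, isOpen_interior.inter isOpen_interior.inv,
      by rw [inter_inv, inv_inv, inter_comm], ⟨h1, by simpa using h1⟩,
      inter_subset_left.trans interior_subset⟩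
  · rintro ⟨U, hU, -, h1, hUE⟩
    obtain ⟨V, hV, hVU⟩ := exists_nhds_split_inv (hU.mem_nhds h1)
    have hpos : m (interior V) ≠ 0 :=
      (isOpen_interior.measure_pos m ⟨1, mem_interior_iff_mem_nhds.2 hV⟩).ne'
    refine ⟨interior V ×ˢ interior V, ⟨_, isOpen_interior.measurableSet, rfl⟩, ?_, fun p hp => ?_⟩
    · rw [Measure.prod_prod]
      exact mul_ne_zero hpos hpos
    · have := hVU p.2 (interior_subset hp.2) p.1 (interior_subset hp.1)
      exact hUE (by rwa [div_eq_mul_inv] at this)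

/-- If all squares were null, the square interior and its `ω`-closure would be marginally empty,
forcing `E = ∅`. -/
theorem containsNonNullSquare_of_generatedBySquares (hG : SatisfiesLebesgueDensity m)
    {E : Set G} (hE : E.Nonempty) (h : GeneratedBySquares m (star E)) :
    ContainsNonNullSquare m (star E) := by
  by_contra hcon
  have hnull : ∀ Q ∈ {Q | IsSquareSet Q ∧ Q ⊆ star E}, MargSubset m Q (star (∅ : Set G)) := by
    rintro _ ⟨⟨α, hα, rfl⟩, hsub⟩
    have h0 : m α = 0 := by
      by_contra h0
      exact hcon ⟨α ×ˢ α, ⟨α, hα, rfl⟩, by rw [Measure.prod_prod]; exact mul_ne_zero h0 h0, hsub⟩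
    exact (MargNull.prod_left h0 α).mono sdiff_subset
  have hint : MargEquiv m (squareInterior m (star E)) (star (∅ : Set G)) :=
    (isOmegaUnion_of_isOpen (isOpen_star isOpen_empty) hnull fun _ hp => hp.elim).omegaUnion
  have hcl := (h.trans hint.omegaClosure).trans (omegaClosure_star hG ∅)
  rw [closure_empty, margEquiv_star_iff] at hcl
  exact hE.ne_empty hcl

/-- With `interior E` symmetric and containing `1`, open squares already cover `star (interior E)`,
so the square interior agrees with the `ω`-interior. -/
theorem generatedBySquares_star (hG : SatisfiesLebesgueDensity m) {E : Set G}
    (hinv : E⁻¹ = E) (hcl : closure (interior E) = E) (h1 : (1 : G) ∈ interior E) :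
    GeneratedBySquares m (star E) := by
  have hinv' : (interior E)⁻¹ = interior E := by
    rw [← Set.inv_preimage]
    exact ((Homeomorph.inv G).preimage_interior E).trans (congrArg interior hinv)
  have hint : MargEquiv m (squareInterior m (star E)) (star (interior E)) := by
    refine (isOmegaUnion_of_isOpen (isOpen_star isOpen_interior)
      (fun Q hQ => hQ.1.isRectangle.margSubset_star_interior hG hQ.2) fun p hp => ?_).omegaUnion
    obtain ⟨Q, hQ, hQo, hpQ, hQE⟩ :=
      exists_isOpen_square_subset_star isOpen_interior hinv' h1 hp
    exact ⟨Q, ⟨hQ, hQE.trans (star_subset_star interior_subset)⟩, hQo, hpQ, hQE⟩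
  have h := hint.omegaClosure.trans (omegaClosure_star hG _)
  rw [hcl] at h
  exact h.symm

end Density

end OmegaTop

theorem mainTheorem8 {G : Type*} [Group G] [TopologicalSpace G] [IsTopologicalGroup G]
    [LocallyCompactSpace G] [SecondCountableTopology G] [MeasurableSpace G] [BorelSpace G]
    (m : Measure G) [m.IsHaarMeasure] (hG : OmegaTop.SatisfiesLebesgueDensity m)
    (E : Set G) (hE : MeasurableSet E) (hmE : 0 < m E) :
    OmegaTop.MargEquiv m (OmegaTop.omegaInterior m (OmegaTop.star E))
      (OmegaTop.star (interior E)) ∧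
    OmegaTop.MargEquiv m (OmegaTop.omegaClosure m (OmegaTop.star E))
      (OmegaTop.star (closure E)) ∧
    (OmegaTop.IsPositivityDomain m (OmegaTop.star E) ↔
      E⁻¹ = E ∧ (1 : G) ∈ E ∧ closure (interior E) = E) ∧
    (OmegaTop.IsPositivityDomain m (OmegaTop.star E) →
      (OmegaTop.GeneratedBySquares m (OmegaTop.star E) ↔
        OmegaTop.ContainsNonNullSquare m (OmegaTop.star E))) ∧
    (OmegaTop.GeneratedBySquares m (OmegaTop.star E) →
      OmegaTop.ContainsNonNullSquare m (OmegaTop.star E)) ∧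
    (OmegaTop.ContainsNonNullSquare m (OmegaTop.star E) ↔
      ∃ U : Set G, IsOpen U ∧ U⁻¹ = U ∧ (1 : G) ∈ U ∧ U ⊆ E) := by
  refine ⟨OmegaTop.omegaInterior_star hG E, OmegaTop.omegaClosure_star hG E,
    OmegaTop.isPositivityDomain_star_iff hG hE, fun hpos => ⟨?_, fun hsq => ?_⟩, ?_,
    OmegaTop.containsNonNullSquare_star_iff hG E⟩
  · exact OmegaTop.containsNonNullSquare_of_generatedBySquares hG
      (nonempty_of_measure_ne_zero hmE.ne')
  · obtain ⟨hinv, -, hcl⟩ := (OmegaTop.isPositivityDomain_star_iff hG hE).1 hpos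
    obtain ⟨U, hU, -, h1, hUE⟩ := (OmegaTop.containsNonNullSquare_star_iff hG E).1 hsq
    exact OmegaTop.generatedBySquares_star hG hinv hcl (interior_maximal hUE hU h1)
  · exact OmegaTop.containsNonNullSquare_of_generatedBySquares hG
      (nonempty_of_measure_ne_zero hmE.ne')
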